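/- Let $n\in\mathbb N$, let $\mu_H$ be the Haar probability measure on $U(2^n)$, and let an ensemble be a Borel probability measure on $U(2^n)$. An experiment with $j$ queries consists of a number $m$ of auxiliary qubits, unitaries $W_0,\dots,W_j$ on $n+m$ qubits, and a choice, for each $i\le j$, of a query $V_i\in\{U,U^T,\bar U,U^\dagger\}$; its output state is $|\mathcal A^U\rangle=W_j(V_j\otimes \mathbb 1)\cdots W_1(V_1\otimes \mathbb 1)W_0|0^{n+m}\rangle$. An ensemble $\mu$ is secure against a class of experiments with measurable error $\varepsilon$ if for each experiment in the class the mean output states for $U\sim\mu$ and $U\sim\mu_H$ are $\varepsilon$-close in trace distance, that is, $$\bigl|\mathbb E_{U\sim\mu}\operatorname{Tr}[O|\mathcal A^U\rangle\langle\mathcal A^U|]-\mathbb E_{U\sim\mu_H}\operatorname{Tr}[O|\mathcal A^U\rangle\langle\mathcal A^U|]\bigr|\le\varepsilon$$ for every observable $0\le O\le \mathbb 1$ on the $n+m$ qubits. A strong $2$-design with measurable error $\varepsilon$ is an ensemble that is secure with measurable error $\varepsilon$ against all experiments with at most two queries. A weak $\varepsilon$-approximate relative-error $2$-design is an ensemble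 $\mu$ for which $(1+\varepsilon)\Phi_{\mu_H}-\Phi_\mu$ and $\Phi_\mu-(1-\varepsilon)\Phi_{\mu_H}$ are completely positive, where $\Phi_\nu(A)=\mathbb E_{U\sim\nu}\,U^{\otimes 2}A(U^{\otimes 2})^\dagger$. Let $\varepsilon_1,\varepsilon_2\in\mathbb R$. Let $\mu_1$ be an ensemble that is secure with measurable error $\varepsilon_1$ against all experiments with exactly two queries, one to $U$ or $U^T$ and the other to $\bar U$ or $U^\dagger$, in either order. Let $\mu_2$ be a weak $\varepsilon_2$-approximate relative-error $2$-design. Then the convolution $\mu_1*\mu_2$, i.e. the law of $U_1U_2$ for independent $U_1\sim\mu_1$ and $U_2\sim\mu_2$, is a strong $2$-design with measurable error $\max(\varepsilon_1,2\varepsilon_2)$. -/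

import Mathlib

open MeasureTheory
open scoped Matrix Kronecker ComplexOrder

noncomputable section

/-! ### Qubit registers and the unitary group, with its Borel σ-algebra and Haar measure -/

/-- Computational basis labels (bit strings) of a register of `n` qubits. -/
abbrev Qubits (n : ℕ) : Type := Fin n → Fin 2

/-- The group `U(2^n)` of unitaries on `n` qubits. -/
abbrev QUnitary (n : ℕ) : Type := Matrix.unitaryGroup (Qubits n) ℂ

instance instMeasurableSpaceQUnitary (n : ℕ) : MeasurableSpace (QUnitary n) := borel _

instance instBorelSpaceQUnitary (n : ℕ) : BorelSpace (QUnitary n) := ⟨rfl⟩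

instance instSecondCountableQUnitary (n : ℕ) : SecondCountableTopology (QUnitary n) := by
  have : SecondCountableTopology (Matrix (Qubits n) (Qubits n) ℂ) :=
    inferInstanceAs (SecondCountableTopology (Qubits n → Qubits n → ℂ))
  exact TopologicalSpace.Subtype.secondCountableTopology
    (Matrix.unitaryGroup (Qubits n) ℂ : Set (Matrix (Qubits n) (Qubits n) ℂ))

instance instCompactSpaceQUnitary (n : ℕ) : CompactSpace (QUnitary n) := by
  refine (isCompact_iff_compactSpace (s := (Matrix.unitaryGroup (Qubits n) ℂ :
    Set (Matrix (Qubits n) (Qubits n) ℂ)))).mp ?_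
  have hK : IsCompact (Set.univ.pi fun _ : Qubits n => Set.univ.pi fun _ : Qubits n =>
      Metric.closedBall (0 : ℂ) 1) :=
    isCompact_univ_pi fun _ => isCompact_univ_pi fun _ => isCompact_closedBall _ _
  refine IsCompact.of_isClosed_subset (X := Matrix (Qubits n) (Qubits n) ℂ) hK ?_ ?_
  · have h : ((Matrix.unitaryGroup (Qubits n) ℂ : Submonoid _) :
        Set (Matrix (Qubits n) (Qubits n) ℂ)) = {A | A * star A = 1} := by
      ext A
      exact Matrix.mem_unitaryGroup_iff
    rw [h]
    exact isClosed_eq (by fun_prop) continuous_const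
  · intro A hA
    exact fun i _ j _ => mem_closedBall_zero_iff.mpr (entry_norm_bound_of_unitary hA i j)

/-- The Haar probability measure on `U(2^n)`. -/
def haarQ (n : ℕ) : Measure (QUnitary n) := Measure.haarMeasure ⊤

instance instIsProbabilityMeasureHaarQ (n : ℕ) : IsProbabilityMeasure (haarQ n) := by
  constructor
  have h := Measure.haarMeasure_self (K₀ := (⊤ : TopologicalSpace.PositiveCompacts (QUnitary n)))
  rwa [TopologicalSpace.PositiveCompacts.coe_top] at h

/-! ### Query experiments -/

/-- The four ways in which an experiment may query a unitary `U`: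
`U`, `Uᵀ`, the entrywise complex conjugate `Ū`, and `U†`. -/
inductive Query
  | fwd
  | transpose
  | conj
  | adjoint

/-- The matrix that is applied by a query. -/
def Query.apply {n : ℕ} (U : QUnitary n) : Query → Matrix (Qubits n) (Qubits n) ℂ
  | .fwd => U.1
  | .transpose => U.1ᵀ
  | .conj => U.1.map (starRingEnd ℂ)
  | .adjoint => U.1ᴴ

/-- Queries to one of `U`, `Uᵀ`. -/
def Query.IsForward : Query → Prop
  | .fwd | .transpose => True
  | .conj | .adjoint => False

/-- Queries to one of `Ū`, `U†`. -/
def Query.IsBackward : Query → Prop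
  | .fwd | .transpose => False
  | .conj | .adjoint => True

/-- An `n`-qubit system register together with `m` auxiliary qubits. -/
abbrev Reg (n m : ℕ) : Type := Qubits n × Qubits m

/-- An adaptive query experiment: `m` auxiliary qubits, an initial unitary `W₀`, and a list of steps
`(V₁, W₁), …, (V_k, W_k)`, each consisting of a query to the system register followed by a
unitary on the whole register. -/
structure Experiment (n : ℕ) where
  m : ℕ
  init : Matrix.unitaryGroup (Reg n m) ℂ
  steps : List (Query × Matrix.unitaryGroup (Reg n m) ℂ)

namespace Experiment

variable {n : ℕ}

/-- The list of query types, in chronological order. -/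
def queries (A : Experiment n) : List Query := A.steps.map Prod.fst

/-- The final state vector `W_k (V_k ⊗ 1) ⋯ W₁ (V₁ ⊗ 1) W₀ |0^{n+m}⟩`. -/
def state (A : Experiment n) (U : QUnitary n) : Reg n A.m → ℂ :=
  A.steps.foldl
    (fun ψ s => s.2.1 *ᵥ ((s.1.apply U ⊗ₖ (1 : Matrix (Qubits A.m) (Qubits A.m) ℂ)) *ᵥ ψ))
    (A.init.1 *ᵥ Pi.single (0, 0) 1)

/-- `Tr[O |A^U⟩⟨A^U|]`. -/
def expectation (A : Experiment n) (O : Matrix (Reg n A.m) (Reg n A.m) ℂ) (U : QUnitary n) : ℂ :=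
  (O * Matrix.vecMulVec (A.state U) (star (A.state U))).trace

end Experiment

/-- The ensemble `μ` is secure with measurable error `ε` against the experiments in `P`: the mean
output state of each of them is `ε`-close in trace distance to its mean output state for a
Haar-random unitary. The trace distance is the largest difference of expectations over
observables `0 ≤ O ≤ 1`. -/
def SecureAgainst {n : ℕ} (P : Experiment n → Prop) (ε : ℝ) (μ : Measure (QUnitary n)) : Prop :=
  ∀ A : Experiment n, P A → ∀ O : Matrix (Reg n A.m) (Reg n A.m) ℂ,
    O.PosSemidef → (1 - O).PosSemidef →
      ‖(∫ U, A.expectation O U ∂μ) - ∫ U, A.expectation O U ∂(haarQ n)‖ ≤ ε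

/-- Experiments with exactly two queries, one of them to `U` or `Uᵀ` and the other one to `Ū` or
`U†`, in either order. -/
def IsMixedPair {n : ℕ} (A : Experiment n) : Prop :=
  ∃ a b : Query, a.IsForward ∧ b.IsBackward ∧ (A.queries = [a, b] ∨ A.queries = [b, a])

/-- Strong `ε`-approximate unitary `k`-designs: security with measurable error `ε` against all
experiments that make at most `k` queries, each to any of `U`, `Uᵀ`, `Ū`, `U†`. -/
def IsStrongDesign {n : ℕ} (k : ℕ) (ε : ℝ) (μ : Measure (QUnitary n)) : Prop :=
  SecureAgainst (fun A => A.queries.length ≤ k) ε μ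

/-! ### Relative-error designs -/

/-- The tensor power `U^{⊗k}`. -/
def tensorPow {n : ℕ} (k : ℕ) (U : QUnitary n) :
    Matrix (Fin k → Qubits n) (Fin k → Qubits n) ℂ :=
  Matrix.of fun x y => ∏ l, U.1 (x l) (y l)

theorem continuous_tensorPow_conj_apply {n : ℕ} (k : ℕ)
    (A : Matrix (Fin k → Qubits n) (Fin k → Qubits n) ℂ) (x y : Fin k → Qubits n) :
    Continuous fun U : QUnitary n => (tensorPow k U * A * (tensorPow k U)ᴴ) x y := by
  have h : Continuous fun U : QUnitary n => tensorPow k U := by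
    refine continuous_matrix fun i j => ?_
    simp only [tensorPow, Matrix.of_apply]
    exact continuous_finsetProd _ fun l _ =>
      (continuous_subtype_val.matrix_elem (i l) (j l))
  exact ((h.matrix_mul continuous_const).matrix_mul h.matrix_conjTranspose).matrix_elem x y

theorem integrable_tensorPow_conj_apply {n : ℕ} (k : ℕ) (μ : Measure (QUnitary n))
    [IsProbabilityMeasure μ]
    (A : Matrix (Fin k → Qubits n) (Fin k → Qubits n) ℂ) (x y : Fin k → Qubits n) :
    Integrable (fun U : QUnitary n => (tensorPow k U * A * (tensorPow k U)ᴴ) x y) μ :=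
  (continuous_tensorPow_conj_apply k A x y).integrable_of_hasCompactSupport
    (HasCompactSupport.of_compactSpace _)

/-- The `k`-fold twirl `A ↦ E_{U ∼ μ} U^{⊗k} A (U^{⊗k})†`. -/
def twirl {n : ℕ} (k : ℕ) (μ : Measure (QUnitary n)) [IsProbabilityMeasure μ] :
    Matrix (Fin k → Qubits n) (Fin k → Qubits n) ℂ →ₗ[ℂ]
      Matrix (Fin k → Qubits n) (Fin k → Qubits n) ℂ where
  toFun A := Matrix.of fun x y => ∫ U, (tensorPow k U * A * (tensorPow k U)ᴴ) x y ∂μ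
  map_add' A B := by
    ext x y
    simp only [Matrix.of_apply, Matrix.add_apply, mul_add, add_mul]
    exact integral_add (integrable_tensorPow_conj_apply k μ A x y)
      (integrable_tensorPow_conj_apply k μ B x y)
  map_smul' c A := by
    ext x y
    simp only [Matrix.of_apply, Matrix.smul_apply, Matrix.mul_smul, Matrix.smul_mul,
      RingHom.id_apply, smul_eq_mul]
    exact integral_const_mul c _

/-- Complete positivity: for each `d`, applying `Φ` to all `d × d` blocks preserves positive
semidefiniteness, that is, `Φ ⊗ id_d` is positive. -/
def IsCompletelyPositive {ι : Type} [Fintype ι] [DecidableEq ι]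
    (Φ : Matrix ι ι ℂ →ₗ[ℂ] Matrix ι ι ℂ) : Prop :=
  ∀ (d : ℕ) (A : Matrix (ι × Fin d) (ι × Fin d) ℂ), A.PosSemidef →
    (Matrix.of fun p q : ι × Fin d =>
      Φ (Matrix.of fun i j => A (i, p.2) (j, q.2)) p.1 q.1).PosSemidef

/-- Weak `ε`-approximate relative-error unitary `k`-designs:
`(1 - ε) Φ_H ⪯ Φ_μ ⪯ (1 + ε) Φ_H`, where `Φ ⪯ Ψ` means that `Ψ - Φ` is completely positive. -/
def IsRelativeErrorDesign {n : ℕ} (k : ℕ) (ε : ℝ) (μ : Measure (QUnitary n))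
    [IsProbabilityMeasure μ] : Prop :=
  IsCompletelyPositive (twirl k μ - ((1 - ε : ℝ) : ℂ) • twirl k (haarQ n)) ∧
  IsCompletelyPositive (((1 + ε : ℝ) : ℂ) • twirl k (haarQ n) - twirl k μ)

end

/-!
The at most two queries are either one forward (`U`, `Uᵀ`) and one backward (`Ū`, `U†`),
or they are all of the same direction; these two cases use the two factors of `μ₁ ∗ₘ μ₂`
separately.

In the mixed case, fix `U₂ = V`. A query to `U₁ * V` is a query to `U₁` between two fixed unitaries,
which the experiment can absorb (`Experiment.exists_expectation_mul`). So the hypothesis on `μ₁`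
applies for each `V`, and the right invariance of Haar measure removes `V` from the Haar side
(`norm_integral_mconv_sub_le_of_right`).

In the other case, fix `U₁ = V`. The amplitudes of the final state, conjugated if the queries are
backward, are homogeneous polynomials of degree at most two in the entries of `U₂`
(`Experiment.map_state_mul_mem`), and the expectation of a positive observable is a sum of squared
moduli of such polynomials. Complete positivity of the two differences of twirls says, through their
Choi matrices, that the mean of `‖g U‖ ^ 2` for such a polynomial `g` of degree two is the same under
`μ₂` and under Haar measure up to relative error `ε₂`
(`IsRelativeErrorDesign.abs_integral_norm_sq_sub_le`). Polynomials of lower degree are reduced to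
degree two by inserting `∑ i, ‖U i 0‖ ^ 2 = 1`. As expectations lie between `0` and `1`, the error is
at most `ε₂`, and `0 ≤ ε₂ ≤ 2 * ε₂`.
-/

noncomputable section

/-! ### Averages of continuous functions over ensembles -/

theorem QUnitary.integrable_of_continuous {n : ℕ} {E : Type*} [NormedAddCommGroup E]
    (μ : Measure (QUnitary n)) [IsFiniteMeasure μ] {f : QUnitary n → E} (hf : Continuous f) :
    Integrable f μ :=
  hf.integrable_of_hasCompactSupport (HasCompactSupport.of_compactSpace _)

/-- Left Haar measure on the compact group `U(2^n)` is right invariant: its right translates are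
again Haar probability measures, and there is only one such measure. -/
instance instIsMulRightInvariantHaarQ (n : ℕ) : (haarQ n).IsMulRightInvariant := by
  have : (haarQ n).IsHaarMeasure := by unfold haarQ; infer_instance
  refine ⟨fun g => ?_⟩
  have : IsProbabilityMeasure ((haarQ n).map (· * g)) :=
    Measure.isProbabilityMeasure_map (by fun_prop)
  exact Measure.isHaarMeasure_eq_of_isProbabilityMeasure _ _

instance instIsMulLeftInvariantHaarQ (n : ℕ) : (haarQ n).IsMulLeftInvariant := by
  unfold haarQ; infer_instance

/-- If all left translates of `f` have nearly the same mean under `μ₂` as under Haar measure, then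
`f` has nearly the same mean under `μ₁ ∗ₘ μ₂`. -/
theorem norm_integral_mconv_sub_le_of_left {n : ℕ} (μ₁ μ₂ : Measure (QUnitary n))
    [IsProbabilityMeasure μ₁] [IsProbabilityMeasure μ₂] {f : QUnitary n → ℂ} (hf : Continuous f)
    {ε : ℝ}
    (h : ∀ V, ‖(∫ U, f (V * U) ∂μ₂) - ∫ U, f (V * U) ∂(haarQ n)‖ ≤ ε) :
    ‖(∫ U, f U ∂(μ₁ ∗ₘ μ₂)) - ∫ U, f U ∂(haarQ n)‖ ≤ ε := by
  have hi : Integrable (fun p : QUnitary n × QUnitary n => f (p.1 * p.2)) (μ₁.prod μ₂) :=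
    (by fun_prop : Continuous fun p : QUnitary n × QUnitary n =>
      f (p.1 * p.2)).integrable_of_hasCompactSupport (HasCompactSupport.of_compactSpace _)
  rw [integral_mconv (QUnitary.integrable_of_continuous _ hf)]
  have hc : ∫ U, f U ∂(haarQ n) = ∫ _V, (∫ U, f U ∂(haarQ n)) ∂μ₁ := by simp
  rw [hc, ← integral_sub hi.integral_prod_left (integrable_const _)]
  refine (norm_integral_le_of_norm_le_const (C := ε) (ae_of_all _ fun V => ?_)).trans (by simp)
  simpa only [integral_mul_left_eq_self (μ := haarQ n) f V] using h V

/-- If all right translates of `f` have nearly the same mean under `μ₁` as under Haar measure, then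
`f` has nearly the same mean under `μ₁ ∗ₘ μ₂`. -/
theorem norm_integral_mconv_sub_le_of_right {n : ℕ} (μ₁ μ₂ : Measure (QUnitary n))
    [IsProbabilityMeasure μ₁] [IsProbabilityMeasure μ₂] {f : QUnitary n → ℂ} (hf : Continuous f)
    {ε : ℝ}
    (h : ∀ V, ‖(∫ U, f (U * V) ∂μ₁) - ∫ U, f (U * V) ∂(haarQ n)‖ ≤ ε) :
    ‖(∫ U, f U ∂(μ₁ ∗ₘ μ₂)) - ∫ U, f U ∂(haarQ n)‖ ≤ ε := by
  have hi : Integrable (fun p : QUnitary n × QUnitary n => f (p.1 * p.2)) (μ₁.prod μ₂) :=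
    (by fun_prop : Continuous fun p : QUnitary n × QUnitary n =>
      f (p.1 * p.2)).integrable_of_hasCompactSupport (HasCompactSupport.of_compactSpace _)
  rw [integral_mconv (QUnitary.integrable_of_continuous _ hf),
    integral_integral_swap (f := fun x y => f (x * y)) hi]
  have hc : ∫ U, f U ∂(haarQ n) = ∫ _V, (∫ U, f U ∂(haarQ n)) ∂μ₂ := by simp
  rw [hc, ← integral_sub hi.integral_prod_right (integrable_const _)]
  refine (norm_integral_le_of_norm_le_const (C := ε) (ae_of_all _ fun V => ?_)).trans (by simp)
  simpa only [integral_mul_right_eq_self (μ := haarQ n) f V] using h V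

/-! ### Queries -/

namespace Query

variable {n : ℕ}

theorem apply_mem_unitaryGroup (U : QUnitary n) (q : Query) :
    q.apply U ∈ Matrix.unitaryGroup (Qubits n) ℂ := by
  cases q
  · exact U.2
  · exact (Matrix.UnitaryGroup.transpose U).2
  · exact (Matrix.UnitaryGroup.map_star U).2
  · exact (star U).2

/-- Querying a product `U * V` is querying `U` between two unitaries that depend only on `V`. -/
theorem exists_apply_mul (V : QUnitary n) (q : Query) :
    ∃ L R : QUnitary n, ∀ U : QUnitary n, q.apply (U * V) = L.1 * q.apply U * R.1 := by
  cases q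
  · exact ⟨1, V, fun U => by simp [apply]⟩
  · exact ⟨Matrix.UnitaryGroup.transpose V, 1, fun U => by simp [apply, Matrix.transpose_mul]⟩
  · refine ⟨1, Matrix.UnitaryGroup.map_star V, fun U => ?_⟩
    simp only [apply, Submonoid.coe_mul, Matrix.map_mul, OneMemClass.coe_one, one_mul]
    rfl
  · exact ⟨star V, 1, fun U => by
      simp [apply, Matrix.conjTranspose_mul, Matrix.star_eq_conjTranspose]⟩

theorem continuous_apply (q : Query) : Continuous fun U : QUnitary n => q.apply U := by
  have h : Continuous fun U : QUnitary n => U.1 := continuous_subtype_val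
  cases q
  · exact h
  · exact h.matrix_transpose
  · exact h.matrix_map Complex.continuous_conj
  · exact h.matrix_conjTranspose

theorem isForward_or_isBackward (q : Query) : q.IsForward ∨ q.IsBackward := by
  cases q <;> simp [IsForward, IsBackward]

end Query

/-! ### Experiments -/

/-- A unitary on the system register, as a unitary on the whole register. -/
def extendUnitary {n : ℕ} (m : ℕ) (U : QUnitary n) : Matrix.unitaryGroup (Reg n m) ℂ :=
  ⟨U.1 ⊗ₖ (1 : Matrix (Qubits m) (Qubits m) ℂ), Matrix.kronecker_mem_unitary U.2 (one_mem _)⟩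

theorem dotProduct_star_mulVec_of_mem_unitaryGroup {ι : Type*} [Fintype ι] [DecidableEq ι]
    {W : Matrix ι ι ℂ} (hW : W ∈ Matrix.unitaryGroup ι ℂ) (ψ : ι → ℂ) :
    star (W *ᵥ ψ) ⬝ᵥ (W *ᵥ ψ) = star ψ ⬝ᵥ ψ := by
  rw [Matrix.star_mulVec, Matrix.dotProduct_mulVec, Matrix.vecMul_vecMul,
    ← Matrix.star_eq_conjTranspose, Matrix.mem_unitaryGroup_iff'.mp hW, Matrix.vecMul_one]

namespace Experiment

variable {n : ℕ}

/-- Induction along the steps of an experiment, for properties of the state as a function of the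
queried unitary that may depend on the number of queries made so far. -/
theorem state_induction (A : Experiment n)
    {P : ℕ → (QUnitary n → Reg n A.m → ℂ) → Prop}
    (init : P 0 fun _ => A.init.1 *ᵥ Pi.single (0, 0) 1)
    (step : ∀ k ψ, ∀ s ∈ A.steps, P k ψ →
      P (k + 1) fun U =>
        s.2.1 *ᵥ ((s.1.apply U ⊗ₖ (1 : Matrix (Qubits A.m) (Qubits A.m) ℂ)) *ᵥ ψ U)) :
    P A.steps.length A.state := by
  obtain ⟨m, W₀, l⟩ := A
  induction l using List.reverseRecOn with
  | nil => exact init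
  | append_singleton l s ih =>
    have h := step _ _ s (by simp) (ih init fun k ψ t ht => step k ψ t (by simp [ht]))
    rw [List.length_append]
    convert h using 1
    · rfl
    funext U
    simp only [state, List.foldl_append, List.foldl_cons, List.foldl_nil]

theorem star_state_dotProduct_state (A : Experiment n) (U : QUnitary n) :
    star (A.state U) ⬝ᵥ A.state U = 1 := by
  refine A.state_induction (P := fun _ ψ => ∀ U, star (ψ U) ⬝ᵥ ψ U = 1) (fun U => ?_)
    (fun k ψ s _ h U => ?_) U
  · rw [dotProduct_star_mulVec_of_mem_unitaryGroup A.init.2]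
    simp
  · rw [dotProduct_star_mulVec_of_mem_unitaryGroup s.2.2,
      dotProduct_star_mulVec_of_mem_unitaryGroup
        (Matrix.kronecker_mem_unitary (s.1.apply_mem_unitaryGroup U) (one_mem _)), h]

theorem continuous_state (A : Experiment n) : Continuous A.state := by
  refine A.state_induction (P := fun _ ψ => Continuous ψ) continuous_const
    (fun k ψ s _ h => continuous_const.matrix_mulVec (Continuous.matrix_mulVec ?_ h))
  exact continuous_matrix fun i j =>
    (((s.1.continuous_apply (n := n)).matrix_elem i.1 j.1).mul continuous_const)

theorem expectation_eq_dotProduct (A : Experiment n) (O : Matrix (Reg n A.m) (Reg n A.m) ℂ)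
    (U : QUnitary n) : A.expectation O U = star (A.state U) ⬝ᵥ (O *ᵥ A.state U) := by
  rw [expectation, Matrix.mul_vecMulVec, Matrix.trace_vecMulVec, dotProduct_comm]

theorem continuous_expectation (A : Experiment n) (O : Matrix (Reg n A.m) (Reg n A.m) ℂ) :
    Continuous (A.expectation O) := by
  rw [show A.expectation O = _ from funext (A.expectation_eq_dotProduct O)]
  exact (A.continuous_state.star).dotProduct
    (continuous_const.matrix_mulVec A.continuous_state)

/-- An experiment with two queries to `U * V` is an experiment with the same two kinds of query to
`U`: the unitary `V` can be absorbed into the fixed unitaries. -/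
theorem exists_expectation_mul (A : Experiment n) {a b : Query} (hA : A.queries = [a, b])
    (O : Matrix (Reg n A.m) (Reg n A.m) ℂ) (V : QUnitary n) :
    ∃ (W₀ : Matrix.unitaryGroup (Reg n A.m) ℂ)
      (s : List (Query × Matrix.unitaryGroup (Reg n A.m) ℂ)),
      (Experiment.mk A.m W₀ s).queries = [a, b] ∧
      ∀ U, A.expectation O (U * V) = (Experiment.mk A.m W₀ s).expectation O U := by
  obtain ⟨m, W₀, s⟩ := A
  match s, hA with
  | [(q₁, W₁), (q₂, W₂)], hA =>
    obtain ⟨rfl, rfl⟩ : q₁ = a ∧ q₂ = b := by simpa [queries] using hA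
    obtain ⟨L₁, R₁, h₁⟩ := q₁.exists_apply_mul V
    obtain ⟨L₂, R₂, h₂⟩ := q₂.exists_apply_mul V
    refine ⟨extendUnitary m R₁ * W₀,
      [(q₁, extendUnitary m R₂ * W₁ * extendUnitary m L₁), (q₂, W₂ * extendUnitary m L₂)],
      rfl, fun U => ?_⟩
    have hk : ∀ X Y Z : Matrix (Qubits n) (Qubits n) ℂ,
        (X * Y * Z) ⊗ₖ (1 : Matrix (Qubits m) (Qubits m) ℂ) =
          (X ⊗ₖ 1) * (Y ⊗ₖ 1) * (Z ⊗ₖ (1 : Matrix (Qubits m) (Qubits m) ℂ)) := fun X Y Z => by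
      simp [← Matrix.mul_kronecker_mul]
    have hs : (Experiment.mk m W₀ [(q₁, W₁), (q₂, W₂)]).state (U * V) =
        (Experiment.mk m (extendUnitary m R₁ * W₀)
          [(q₁, extendUnitary m R₂ * W₁ * extendUnitary m L₁),
            (q₂, W₂ * extendUnitary m L₂)]).state U := by
      simp only [state, List.foldl_cons, List.foldl_nil, h₁, h₂, hk, extendUnitary,
        Submonoid.coe_mul, Matrix.mulVec_mulVec]
      simp only [Matrix.mul_assoc]
    simp only [expectation, hs]

end Experiment

/-! ### Relative-error designs and sums of squares of polynomials in the matrix entries -/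

/-- The linear forms in the matrix entries, as functions on `U(2^n)`. Its `k`-th power as a submodule
consists of the homogeneous polynomials of degree `k` in the matrix entries (and not in their
conjugates). -/
def entryForms (n : ℕ) : Submodule ℂ (QUnitary n → ℂ) :=
  Submodule.span ℂ (Set.range fun (p : Qubits n × Qubits n) (U : QUnitary n) => U.1 p.1 p.2)

theorem entry_mem_entryForms {n : ℕ} (i j : Qubits n) :
    (fun U : QUnitary n => U.1 i j) ∈ entryForms n :=
  Submodule.subset_span ⟨(i, j), rfl⟩

/-- A homogeneous polynomial of degree `k` in the entries of `U` is a linear form in the entries of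
`U^{⊗k}`. -/
theorem exists_eq_sum_tensorPow {n k : ℕ} {g : QUnitary n → ℂ} (hg : g ∈ entryForms n ^ k) :
    ∃ c : (Fin k → Qubits n) × (Fin k → Qubits n) → ℂ,
      ∀ U, g U = ∑ p, c p * tensorPow k U p.1 p.2 := by
  have hle : entryForms n ^ k ≤ Submodule.span ℂ
      (Set.range fun (p : (Fin k → Qubits n) × (Fin k → Qubits n)) (U : QUnitary n) =>
        tensorPow k U p.1 p.2) := by
    rw [entryForms, Submodule.span_pow]
    refine Submodule.span_mono fun f hf => ?_
    obtain ⟨s, rfl⟩ := Set.mem_pow.mp hf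
    choose p hp using fun l => (s l).2
    refine ⟨(fun l => (p l).1, fun l => (p l).2), ?_⟩
    funext U
    simp [tensorPow, List.prod_ofFn, ← hp]
  obtain ⟨c, hc⟩ := (Submodule.mem_span_range_iff_exists_fun ℂ).mp (hle hg)
  exact ⟨c, fun U => by simp [← hc]⟩

theorem continuous_tensorPow_apply {n : ℕ} (k : ℕ) (x y : Fin k → Qubits n) :
    Continuous fun U : QUnitary n => tensorPow k U x y := by
  simp only [tensorPow, Matrix.of_apply]
  exact continuous_finsetProd _ fun l _ => continuous_subtype_val.matrix_elem (x l) (y l)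

theorem continuous_of_mem_entryForms_pow {n k : ℕ} {g : QUnitary n → ℂ}
    (hg : g ∈ entryForms n ^ k) : Continuous g := by
  obtain ⟨c, hc⟩ := exists_eq_sum_tensorPow hg
  rw [show g = _ from funext hc]
  exact continuous_finsetSum _ fun p _ =>
    continuous_const.mul (continuous_tensorPow_apply k p.1 p.2)

/-- The Choi matrix of a linear map on matrices. -/
def choiMatrix {ι : Type} [DecidableEq ι] (Φ : Matrix ι ι ℂ →ₗ[ℂ] Matrix ι ι ℂ) :
    Matrix (ι × ι) (ι × ι) ℂ :=
  Matrix.of fun p q => Φ (Matrix.single p.2 q.2 1) p.1 q.1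

theorem IsCompletelyPositive.posSemidef_choiMatrix {ι : Type} [Fintype ι] [DecidableEq ι]
    {Φ : Matrix ι ι ℂ →ₗ[ℂ] Matrix ι ι ℂ} (h : IsCompletelyPositive Φ) :
    (choiMatrix Φ).PosSemidef := by
  let e := Fintype.equivFin ι
  -- The unnormalised maximally entangled state.
  let v : ι × Fin (Fintype.card ι) → ℂ := fun p => if p.1 = e.symm p.2 then 1 else 0
  have hp := (h _ _ (Matrix.posSemidef_vecMulVec_self_star v)).submatrix
    (fun p : ι × ι => (p.1, e p.2))
  convert hp using 1
  ext p q
  simp only [choiMatrix, Matrix.of_apply, Matrix.submatrix_apply]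
  refine congrFun (congrFun (congrArg Φ (Matrix.ext fun i j => ?_)) p.1) q.1
  simp only [Matrix.single_apply, Matrix.vecMulVec_apply, Pi.star_apply, v, e,
    Matrix.of_apply, Equiv.symm_apply_apply, eq_comm (a := p.2), eq_comm (a := q.2)]
  by_cases h1 : i = p.2 <;> by_cases h2 : j = q.2 <;> simp [h1, h2]

theorem choiMatrix_twirl_quadraticForm {n : ℕ} (k : ℕ) (μ : Measure (QUnitary n))
    [IsProbabilityMeasure μ] (c : (Fin k → Qubits n) × (Fin k → Qubits n) → ℂ) :
    c ⬝ᵥ (choiMatrix (twirl k μ) *ᵥ star c) =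
      ((∫ U, ‖∑ p, c p * tensorPow k U p.1 p.2‖ ^ 2 ∂μ : ℝ) : ℂ) := by
  have hC : ∀ p q, choiMatrix (twirl k μ) p q =
      ∫ U, tensorPow k U p.1 p.2 * star (tensorPow k U q.1 q.2) ∂μ := fun p q => by
    simp [choiMatrix, twirl, Matrix.mul_apply, Matrix.single_apply, Matrix.conjTranspose_apply,
      ite_and]
  have hint : ∀ p q : (Fin k → Qubits n) × (Fin k → Qubits n), Integrable (fun U =>
      c p * (tensorPow k U p.1 p.2 * star (tensorPow k U q.1 q.2) * star (c q))) μ := fun p q =>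
    QUnitary.integrable_of_continuous μ <| continuous_const.mul <|
      ((continuous_tensorPow_apply k _ _).mul (continuous_tensorPow_apply k _ _).star).mul
        continuous_const
  have hsq : ∀ U : QUnitary n, ((‖∑ p, c p * tensorPow k U p.1 p.2‖ ^ 2 : ℝ) : ℂ) =
      ∑ p, ∑ q, c p * (tensorPow k U p.1 p.2 * star (tensorPow k U q.1 q.2) * star (c q)) := by
    intro U
    rw [Complex.ofReal_pow, ← Complex.mul_conj', map_sum, Finset.sum_mul_sum]
    refine Finset.sum_congr rfl fun p _ => Finset.sum_congr rfl fun q _ => ?_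
    rw [map_mul, ← starRingEnd_apply, ← starRingEnd_apply]
    ring
  rw [← integral_complex_ofReal]
  simp_rw [hsq]
  rw [integral_finsetSum _ fun p _ => integrable_finsetSum _ fun q _ => hint p q]
  refine Finset.sum_congr rfl fun p _ => ?_
  rw [integral_finsetSum _ fun q _ => hint p q, Matrix.mulVec, dotProduct, Finset.mul_sum]
  refine Finset.sum_congr rfl fun q _ => ?_
  rw [integral_const_mul, integral_mul_const, hC, Pi.star_apply]

namespace IsRelativeErrorDesign

variable {n k : ℕ} {ε : ℝ} {μ : Measure (QUnitary n)} [IsProbabilityMeasure μ]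

theorem abs_integral_norm_sq_sub_le (h : IsRelativeErrorDesign k ε μ) {g : QUnitary n → ℂ}
    (hg : g ∈ entryForms n ^ k) :
    |(∫ U, ‖g U‖ ^ 2 ∂μ) - ∫ U, ‖g U‖ ^ 2 ∂(haarQ n)| ≤ ε * ∫ U, ‖g U‖ ^ 2 ∂(haarQ n) := by
  obtain ⟨c, hc⟩ := exists_eq_sum_tensorPow hg
  simp_rw [hc]
  have h₁ := h.1.posSemidef_choiMatrix.dotProduct_mulVec_nonneg (star c)
  have h₂ := h.2.posSemidef_choiMatrix.dotProduct_mulVec_nonneg (star c)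
  have e₁ : choiMatrix (twirl k μ - ((1 - ε : ℝ) : ℂ) • twirl k (haarQ n)) =
      choiMatrix (twirl k μ) - ((1 - ε : ℝ) : ℂ) • choiMatrix (twirl k (haarQ n)) := rfl
  have e₂ : choiMatrix (((1 + ε : ℝ) : ℂ) • twirl k (haarQ n) - twirl k μ) =
      ((1 + ε : ℝ) : ℂ) • choiMatrix (twirl k (haarQ n)) - choiMatrix (twirl k μ) := rfl
  rw [star_star, e₁, Matrix.sub_mulVec, Matrix.smul_mulVec, dotProduct_sub, dotProduct_smul,
    choiMatrix_twirl_quadraticForm, choiMatrix_twirl_quadraticForm, smul_eq_mul,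
    ← Complex.ofReal_mul, ← Complex.ofReal_sub, Complex.zero_le_real] at h₁
  rw [star_star, e₂, Matrix.sub_mulVec, Matrix.smul_mulVec, dotProduct_sub, dotProduct_smul,
    choiMatrix_twirl_quadraticForm, choiMatrix_twirl_quadraticForm, smul_eq_mul,
    ← Complex.ofReal_mul, ← Complex.ofReal_sub, Complex.zero_le_real] at h₂
  rw [abs_le]
  constructor <;> linarith

/-- The means of a sum of squares of polynomials of degree `j ≤ k` agree up to relative error. Below
degree `k`, the degree is raised by inserting `∑ i, ‖U i 0‖ ^ 2 = 1`. -/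
theorem abs_integral_sum_norm_sq_sub_le (h : IsRelativeErrorDesign k ε μ) {j : ℕ} (hj : j ≤ k)
    {κ : Type} [Fintype κ] {g : κ → QUnitary n → ℂ} (hg : ∀ r, g r ∈ entryForms n ^ j) :
    |(∫ U, ∑ r, ‖g r U‖ ^ 2 ∂μ) - ∫ U, ∑ r, ‖g r U‖ ^ 2 ∂(haarQ n)| ≤
      ε * ∫ U, ∑ r, ‖g r U‖ ^ 2 ∂(haarQ n) := by
  induction hj using Nat.decreasingInduction generalizing κ with
  | self =>
    have hi : ∀ (ν : Measure (QUnitary n)) [IsProbabilityMeasure ν] (r : κ),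
        Integrable (fun U => ‖g r U‖ ^ 2) ν := fun ν _ r =>
      QUnitary.integrable_of_continuous ν ((continuous_of_mem_entryForms_pow (hg r)).norm.pow 2)
    rw [integral_finsetSum _ fun r _ => hi μ r, integral_finsetSum _ fun r _ => hi (haarQ n) r,
      ← Finset.sum_sub_distrib, Finset.mul_sum]
    exact (Finset.abs_sum_le_sum_abs _ _).trans
      (Finset.sum_le_sum fun r _ => h.abs_integral_norm_sq_sub_le (hg r))
  | of_succ j _ ih =>
    have hcol : ∀ U : QUnitary n, ∑ i, ‖U.1 i 0‖ ^ 2 = 1 := fun U => by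
      have := congrFun (congrFun (Matrix.mem_unitaryGroup_iff'.mp U.2) 0) 0
      simp only [Matrix.mul_apply, Matrix.star_apply, Matrix.one_apply_eq, ← starRingEnd_apply,
        Complex.conj_mul'] at this
      exact_mod_cast this
    have hs : ∀ U, ∑ r, ‖g r U‖ ^ 2 = ∑ p : κ × Qubits n, ‖g p.1 U * U.1 p.2 0‖ ^ 2 := fun U => by
      simp_rw [norm_mul, mul_pow, Fintype.sum_prod_type, ← Finset.mul_sum, hcol, mul_one]
    simp_rw [hs]
    exact ih (g := fun (p : κ × Qubits n) U => g p.1 U * U.1 p.2 0) fun p => by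
      rw [pow_succ]
      exact Submodule.mul_mem_mul (hg p.1) (entry_mem_entryForms p.2 0)

theorem nonneg (h : IsRelativeErrorDesign k ε μ) : 0 ≤ ε := by
  have := h.abs_integral_sum_norm_sq_sub_le (Nat.zero_le k) (κ := Unit) (g := fun _ => 1)
    fun _ => by rw [pow_zero]; exact Submodule.one_le.mp le_rfl
  simpa using this

end IsRelativeErrorDesign

/-! ### Experiments whose queries are all forward or all backward -/

namespace Experiment

variable {n : ℕ}

/-- If, up to a ring homomorphism `σ` of `ℂ` (the identity or complex conjugation), every query has
entries linear in the entries of `U`, then the amplitudes of the final state are, up to `σ`,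
homogeneous polynomials in the entries of `U`, of degree the number of queries. -/
theorem map_state_mul_mem (σ : ℂ →+* ℂ) (V : QUnitary n) (A : Experiment n)
    (hA : ∀ s ∈ A.steps, ∀ i j, (fun U => σ (s.1.apply (V * U) i j)) ∈ entryForms n)
    (r : Reg n A.m) :
    (fun U => σ (A.state (V * U) r)) ∈ entryForms n ^ A.steps.length := by
  have sum_mem : ∀ {k : ℕ} {f : Reg n A.m → QUnitary n → ℂ}, (∀ t, f t ∈ entryForms n ^ k) →
      (fun U => ∑ t, f t U) ∈ entryForms n ^ k := fun {k f} hf => by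
    rw [show (fun U => ∑ t, f t U) = ∑ t, f t by ext U; simp]
    exact Submodule.sum_mem _ fun t _ => hf t
  refine A.state_induction
    (P := fun k ψ => ∀ r, (fun U => σ (ψ (V * U) r)) ∈ entryForms n ^ k) (fun r => ?_)
    (fun k ψ s hs ih r => ?_) r
  · rw [pow_zero]
    exact Submodule.mem_one.mpr ⟨_, rfl⟩
  · simp only [Matrix.mulVec, dotProduct, map_sum, map_mul]
    refine sum_mem fun t => Submodule.smul_mem _ (σ (s.2.1 r t)) (sum_mem fun u => ?_)
    rw [pow_succ']
    refine Submodule.mul_mem_mul ?_ (ih u)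
    simp only [Matrix.kroneckerMap_apply, map_mul, mul_comm _ (σ ((1 : Matrix _ _ ℂ) t.2 u.2))]
    exact Submodule.smul_mem _ _ (hA s hs t.1 u.1)

/-- With an observable written as `O = Bᴴ * B`, the expectation is the sum of squares `‖B ψ‖²`, to
which the relative-error bound applies; as the Haar mean is at most `1`, the relative error is also
an absolute one. -/
theorem norm_integral_expectation_mul_sub_le (σ : ℂ →+* ℂ) (hσ : ∀ z, ‖σ z‖ = ‖z‖) {ε : ℝ} {k : ℕ}
    {μ : Measure (QUnitary n)} [IsProbabilityMeasure μ] (h : IsRelativeErrorDesign k ε μ)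
    (V : QUnitary n) (A : Experiment n) (hk : A.steps.length ≤ k)
    (hA : ∀ s ∈ A.steps, ∀ i j, (fun U => σ (s.1.apply (V * U) i j)) ∈ entryForms n)
    {O : Matrix (Reg n A.m) (Reg n A.m) ℂ} (hO : O.PosSemidef) (hO' : (1 - O).PosSemidef) :
    ‖(∫ U, A.expectation O (V * U) ∂μ) - ∫ U, A.expectation O (V * U) ∂(haarQ n)‖ ≤ ε := by
  obtain ⟨B, hB⟩ : ∃ B : Matrix (Reg n A.m) (Reg n A.m) ℂ, O = Bᴴ * B := by
    open scoped MatrixOrder in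
    exact CStarAlgebra.nonneg_iff_eq_star_mul_self.mp hO.nonneg
  have hexp : ∀ U, A.expectation O U = ((∑ r, ‖σ ((B *ᵥ A.state U) r)‖ ^ 2 : ℝ) : ℂ) := fun U => by
    rw [expectation_eq_dotProduct, hB, ← Matrix.mulVec_mulVec, Matrix.dotProduct_mulVec,
      Matrix.vecMul_conjTranspose, star_star, dotProduct, Complex.ofReal_sum]
    refine Finset.sum_congr rfl fun r _ => ?_
    rw [hσ, Complex.ofReal_pow, ← Complex.conj_mul']
    rfl
  have hle : ∀ U, ∑ r, ‖σ ((B *ᵥ A.state U) r)‖ ^ 2 ≤ 1 := fun U => by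
    have := hO'.dotProduct_mulVec_nonneg (A.state U)
    rw [Matrix.sub_mulVec, Matrix.one_mulVec, dotProduct_sub, star_state_dotProduct_state,
      ← expectation_eq_dotProduct, hexp, sub_nonneg] at this
    exact_mod_cast this
  have hmem : ∀ r, (fun U => σ ((B *ᵥ A.state (V * U)) r)) ∈ entryForms n ^ A.steps.length :=
    fun r => by
      rw [show (fun U => σ ((B *ᵥ A.state (V * U)) r)) =
          ∑ t, σ (B r t) • fun U => σ (A.state (V * U) t) by
        ext U; simp [Matrix.mulVec, dotProduct]]
      exact Submodule.sum_mem _ fun t _ =>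
        Submodule.smul_mem _ _ (A.map_state_mul_mem σ V hA t)
  have hcont : Continuous fun U => ∑ r, ‖σ ((B *ᵥ A.state (V * U)) r)‖ ^ 2 :=
    continuous_finsetSum _ fun r _ => (continuous_of_mem_entryForms_pow (hmem r)).norm.pow 2
  have hone : ∫ U, ∑ r, ‖σ ((B *ᵥ A.state (V * U)) r)‖ ^ 2 ∂(haarQ n) ≤ 1 :=
    (integral_mono (QUnitary.integrable_of_continuous _ hcont) (integrable_const 1)
      fun U => hle (V * U)).trans (by simp)
  simp_rw [hexp]
  rw [integral_complex_ofReal, integral_complex_ofReal, ← Complex.ofReal_sub, Complex.norm_real,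
    Real.norm_eq_abs]
  exact (h.abs_integral_sum_norm_sq_sub_le hk hmem).trans (mul_le_of_le_one_right h.nonneg hone)

end Experiment

theorem entry_mul_mem_entryForms {n : ℕ} (V : QUnitary n) (i j : Qubits n) :
    (fun U : QUnitary n => (V * U).1 i j) ∈ entryForms n := by
  rw [show (fun U : QUnitary n => (V * U).1 i j) = ∑ l, V.1 i l • fun U : QUnitary n => U.1 l j by
    ext U; simp [Matrix.mul_apply]]
  exact Submodule.sum_mem _ fun l _ => Submodule.smul_mem _ _ (entry_mem_entryForms l j)

theorem Query.IsForward.apply_mul_mem {n : ℕ} {q : Query} (hq : q.IsForward) (V : QUnitary n)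
    (i j : Qubits n) : (fun U => q.apply (V * U) i j) ∈ entryForms n := by
  cases q
  · exact entry_mul_mem_entryForms V i j
  · exact entry_mul_mem_entryForms V j i
  · exact hq.elim
  · exact hq.elim

theorem Query.IsBackward.conj_apply_mul_mem {n : ℕ} {q : Query} (hq : q.IsBackward)
    (V : QUnitary n) (i j : Qubits n) :
    (fun U => starRingEnd ℂ (q.apply (V * U) i j)) ∈ entryForms n := by
  cases q
  · exact hq.elim
  · exact hq.elim
  · simpa [Query.apply] using entry_mul_mem_entryForms V i j
  · simpa [Query.apply] using entry_mul_mem_entryForms V j i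

theorem Experiment.queries_trichotomy {n : ℕ} (A : Experiment n) (hA : A.queries.length ≤ 2) :
    (∀ s ∈ A.steps, s.1.IsForward) ∨ (∀ s ∈ A.steps, s.1.IsBackward) ∨ IsMixedPair A := by
  obtain ⟨m, W₀, l⟩ := A
  match l, hA with
  | [], _ => simp
  | [(a, _)], _ => simpa using (a.isForward_or_isBackward).imp id Or.inl
  | [(a, _), (b, _)], _ =>
    rcases a.isForward_or_isBackward with ha | ha <;>
      rcases b.isForward_or_isBackward with hb | hb
    · exact .inl (by simp [ha, hb])
    · exact .inr (.inr ⟨a, b, ha, hb, .inl rfl⟩)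
    · exact .inr (.inr ⟨b, a, hb, ha, .inr rfl⟩)
    · exact .inr (.inl (by simp [ha, hb]))
  | _ :: _ :: _ :: _, h => simp [Experiment.queries] at h

end

theorem lemma4 (n : ℕ) (μ₁ μ₂ : Measure (QUnitary n))
    [IsProbabilityMeasure μ₁] [IsProbabilityMeasure μ₂]
    (ε₁ ε₂ : ℝ)
    (h₁ : SecureAgainst IsMixedPair ε₁ μ₁)
    (h₂ : IsRelativeErrorDesign 2 ε₂ μ₂) :
    IsStrongDesign 2 (max ε₁ (2 * ε₂)) (μ₁ ∗ₘ μ₂) := by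
  intro A hA O hO hO'
  have hcont := A.continuous_expectation O
  have hlen : A.steps.length ≤ 2 := by simpa [Experiment.queries] using hA
  have hε : ε₂ ≤ max ε₁ (2 * ε₂) := le_max_of_le_right (by linarith [h₂.nonneg])
  rcases A.queries_trichotomy hA with hf | hb | hm
  · refine (norm_integral_mconv_sub_le_of_left μ₁ μ₂ hcont fun V => ?_).trans hε
    exact A.norm_integral_expectation_mul_sub_le (RingHom.id ℂ) (fun _ => rfl) h₂ V hlen
      (fun s hs => (hf s hs).apply_mul_mem V) hO hO'
  · refine (norm_integral_mconv_sub_le_of_left μ₁ μ₂ hcont fun V => ?_).trans hε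
    exact A.norm_integral_expectation_mul_sub_le (starRingEnd ℂ) Complex.norm_conj h₂ V hlen
      (fun s hs => (hb s hs).conj_apply_mul_mem V) hO hO'
  · refine (norm_integral_mconv_sub_le_of_right μ₁ μ₂ hcont fun V => ?_).trans (le_max_left _ _)
    obtain ⟨a, b, ha, hb, hq⟩ := hm
    obtain ⟨c, d, hq'⟩ : ∃ c d, A.queries = [c, d] := hq.elim (⟨_, _, ·⟩) (⟨_, _, ·⟩)
    obtain ⟨W₀, s, hs, hexp⟩ := A.exists_expectation_mul hq' O V
    rw [funext hexp]
    exact h₁ ⟨A.m, W₀, s⟩ ⟨a, b, ha, hb, by rwa [hs, ← hq']⟩ O hO hO'
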